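/- Let $n\ge 1$ and consider the market on a filtered probability space $(\Omega,(\mathcal F_t)_{t\ge0},\mathbb P)$ with a bond $B_t=e^{rt}$ and $n$ stocks in geometric Brownian motion, $dS_{it}/S_{it}=\mu_i\,dt+\sigma_i\,dW_{it}$, $S_{i0}>0$, $\sigma_i>0$, where the $W_i$ are standard $(\mathcal F_t)$-Brownian motions with invertible instantaneous correlation matrix $R=[\rho_{ij}]$. For $b\in\mathbb R^n$ let $V_t(b)$ be the wealth at time $t$ of a one-dollar deposit into the rebalancing rule that continuously keeps the fraction $b_i$ of wealth in stock $i$ and the rest in the bond, that is, with $\Sigma=[\rho_{ij}\sigma_i\sigma_j]$ and $\mathbf 1=(1,\dots,1)'$, $$V_t(b)=\exp\Big\{\big[r+(\mu-r\mathbf 1)'b-\tfrac12 b'\Sigma b\big]t+\sum_{i=1}^n b_i\sigma_iW_{it}\Big\}.$$ For every $t>0$ the maximum $V_t^*=\max_{b\in\mathbb R^n}V_t(b)$ exists. Cover's Derivative with expiry $T$ and zero exercise price is the claim that pays $V_T^*$ at $T$ (European version), respectively $V_\tau^*$ upon exercise at a time $\tau\le T$ chosen by the holder (American version). Let $\mathbb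 Q$ be the equivalent martingale measure on horizon $T$, with density $d\mathbb Q/d\mathbb P=\exp\{-\lambda'W_T-\tfrac12\lambda'R\lambda\,T\}$, where $\lambda=R^{-1}\big((\mu_i-r)/\sigma_i\big)_{i=1}^n$; it is equivalent to $\mathbb P$, and the discounted stock prices $e^{-rt}S_{it}$ are $\mathbb Q$-martingales on $[0,T]$. For $0<t\le T$ let $$C_e(t)=\mathbb E^{\mathbb Q}\big[e^{-r(T-t)}V_T^*\,\big|\,\mathcal F_t\big],\qquad C_a(t)=\operatorname*{ess\,sup}_{\tau}\ \mathbb E^{\mathbb Q}\big[e^{-r(\tau-t)}V_\tau^*\,\big|\,\mathcal F_t\big]$$ be the European and the American price at time $t$, the essential supremum being over all stopping times $\tau$ with values in $[t,T]$ (conditional expectations of nonnegative, not necessarily integrable random variables). Then, almost surely, $$C_a(t)=C_e(t)=(T/t)^{n/2}\,V_t^*\qquad(0<t\le T),$$ and $C_a(t)>V_t^*$ for $0<t<T$. The American version is never exercised early: for every $0<t\le T$, a stopping time $\tau$ with values in $[t,T]$ attains the essential supremum if and only if $\tau=T$ almost surely. -/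

import Mathlib

open MeasureTheory ProbabilityTheory
open scoped NNReal ENNReal Matrix

noncomputable section

/-- `W` is an `n`-dimensional Brownian motion relative to the filtration `ℱ`, with coordinates that
are standard Brownian motions of instantaneous correlation matrix `R`: it is adapted, starts at `0`,
has almost surely continuous paths, and the increment over `[s, t]` is independent of `ℱ s` and
centred Gaussian with covariance matrix `(t - s) R`. -/
structure IsCorrelatedBrownian {Ω : Type*} {mΩ : MeasurableSpace Ω} {n : ℕ}
    (R : Matrix (Fin n) (Fin n) ℝ) (ℱ : Filtration ℝ≥0 mΩ)
    (W : ℝ≥0 → Ω → EuclideanSpace ℝ (Fin n)) (P : Measure Ω) : Prop where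
  adapted : ∀ t, Measurable[ℱ t] (W t)
  start_zero : ∀ᵐ ω ∂P, W 0 ω = 0
  continuous_paths : ∀ᵐ ω ∂P, Continuous fun t => W t ω
  indep_past : ∀ s t : ℝ≥0, s ≤ t →
    Indep (MeasurableSpace.comap (fun ω => W t ω - W s ω) inferInstance) (ℱ s) P
  law_increment : ∀ s t : ℝ≥0, s ≤ t →
    HasLaw (fun ω => W t ω - W s ω) (multivariateGaussian 0 (((t : ℝ) - (s : ℝ)) • R)) P

/-- The parameters of the market with `n` correlated stocks in geometric Brownian motion and a
risk-free bond: initial prices, drifts, volatilities, interest rate, and the (invertible)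
correlation matrix of the driving Brownian motions. -/
structure GBMMarket (n : ℕ) where
  S₀ : Fin n → ℝ
  μ : Fin n → ℝ
  σ : Fin n → ℝ
  r : ℝ
  R : Matrix (Fin n) (Fin n) ℝ
  S₀_pos : ∀ i, 0 < S₀ i
  σ_pos : ∀ i, 0 < σ i
  R_posSemidef : R.PosSemidef
  R_diag : ∀ i, R i i = 1
  R_isUnit : IsUnit R

namespace GBMMarket

variable {Ω : Type*} {mΩ : MeasurableSpace Ω} {n : ℕ}

/-- The covariance matrix of instantaneous returns per unit time. -/
def cov (m : GBMMarket n) : Matrix (Fin n) (Fin n) ℝ :=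
  Matrix.diagonal m.σ * m.R * Matrix.diagonal m.σ

/-- The price of stock `i`: the solution of `dS_i / S_i = μ_i dt + σ_i dW_i`. -/
def price (m : GBMMarket n) (W : ℝ≥0 → Ω → EuclideanSpace ℝ (Fin n)) (i : Fin n)
    (t : ℝ≥0) (ω : Ω) : ℝ :=
  m.S₀ i * Real.exp ((m.μ i - m.σ i ^ 2 / 2) * t + m.σ i * W t ω i)

/-- The wealth at time `t` of a one dollar deposit at time `0` into the rebalancing rule `b`: the
solution of `dV / V = ∑ i, b_i dS_i / S_i + (1 - ∑ i, b_i) r dt` with `V_0 = 1`. -/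
def wealth (m : GBMMarket n) (W : ℝ≥0 → Ω → EuclideanSpace ℝ (Fin n)) (b : Fin n → ℝ)
    (t : ℝ≥0) (ω : Ω) : ℝ :=
  Real.exp ((m.r + (∑ i, (m.μ i - m.r) * b i) - (b ⬝ᵥ (m.cov *ᵥ b)) / 2) * t
    + ∑ i, b i * m.σ i * W t ω i)

/-- The wealth at time `t` of the best (levered) rebalancing rule in hindsight over `[0, t]`; this
is what Cover's derivative pays when it is exercised at `t`. -/
def hindsightWealth (m : GBMMarket n) (W : ℝ≥0 → Ω → EuclideanSpace ℝ (Fin n))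
    (t : ℝ≥0) (ω : Ω) : ℝ :=
  ⨆ b : Fin n → ℝ, m.wealth W b t ω

/-- The market price of risk, relative to the correlated Brownian motion. -/
def riskPremium (m : GBMMarket n) : Fin n → ℝ :=
  m.R⁻¹ *ᵥ fun i => (m.μ i - m.r) / m.σ i

/-- The risk-neutral measure with horizon `T`, given by its Girsanov density. -/
def riskNeutral (m : GBMMarket n) (W : ℝ≥0 → Ω → EuclideanSpace ℝ (Fin n)) (P : Measure Ω)
    (T : ℝ≥0) : Measure Ω :=
  P.withDensity fun ω => ENNReal.ofReal
    (Real.exp (-(∑ i, m.riskPremium i * W T ω i)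
      - (m.riskPremium ⬝ᵥ (m.R *ᵥ m.riskPremium)) / 2 * T))

/-- `Q` is an equivalent martingale measure for the market over `[0, T]`: it is a probability
measure equivalent to `P` under which the discounted stock prices are martingales over `[0, T]`
(expressed through the processes frozen at time `T`). -/
structure IsEquivalentMartingaleMeasure (m : GBMMarket n)
    (W : ℝ≥0 → Ω → EuclideanSpace ℝ (Fin n)) (ℱ : Filtration ℝ≥0 mΩ) (P : Measure Ω) (T : ℝ≥0)
    (Q : Measure Ω) : Prop where
  isProbability : IsProbabilityMeasure Q
  absolutelyContinuous : Q ≪ P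
  absolutelyContinuous' : P ≪ Q
  martingale : ∀ i, Martingale
    (fun (u : ℝ≥0) ω => Real.exp (-m.r * ((min u T : ℝ≥0) : ℝ)) * m.price W i (min u T) ω) ℱ Q

end GBMMarket

/-- An exercise policy over `[t, T]`: a stopping time with values in `[t, T]`. -/
structure IsExerciseTime {Ω : Type*} {mΩ : MeasurableSpace Ω} (ℱ : Filtration ℝ≥0 mΩ)
    (t T : ℝ≥0) (τ : Ω → ℝ≥0) : Prop where
  isStoppingTime : IsStoppingTime ℱ fun ω => (τ ω : WithTop ℝ≥0)
  ge_start : ∀ ω, t ≤ τ ω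
  le_expiry : ∀ ω, τ ω ≤ T

/-- The value at time `t` of receiving the (nonnegative) payoff `g (τ ω) ω` at time `τ ω`: the
conditional expectation under the pricing measure `Q`, given `ℱ t`, of the payoff discounted to
time `t` at rate `r`. The payoff need not be integrable, so that the conditional expectation is the
one for `[0, ∞]`-valued functions. -/
def valueOfExercise {Ω : Type*} {mΩ : MeasurableSpace Ω} (Q : Measure Ω) (ℱ : Filtration ℝ≥0 mΩ)
    (r : ℝ) (g : ℝ≥0 → Ω → ℝ) (t : ℝ≥0) (τ : Ω → ℝ≥0) : Ω → ℝ≥0∞ :=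
  condLExp (ℱ t) Q
    (fun ω => ENNReal.ofReal (Real.exp (-r * ((τ ω : ℝ) - (t : ℝ))) * g (τ ω) ω))

/-- The price at time `t` of the European claim that pays `g T` at `T`. -/
def europeanPrice {Ω : Type*} {mΩ : MeasurableSpace Ω} (Q : Measure Ω) (ℱ : Filtration ℝ≥0 mΩ)
    (r : ℝ) (g : ℝ≥0 → Ω → ℝ) (T t : ℝ≥0) : Ω → ℝ≥0∞ :=
  valueOfExercise Q ℱ r g t fun _ => T

/-- `C` is the price at time `t` of the American claim that expires at `T` and pays `g u` upon
exercise at `u`: it is `ℱ t`-measurable and it is the essential supremum, over all exercise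
policies, of the value of exercise. -/
structure IsAmericanPrice {Ω : Type*} {mΩ : MeasurableSpace Ω} (Q : Measure Ω)
    (ℱ : Filtration ℝ≥0 mΩ) (r : ℝ) (g : ℝ≥0 → Ω → ℝ) (T t : ℝ≥0) (C : Ω → ℝ≥0∞) : Prop where
  measurable : Measurable[ℱ t] C
  value_le : ∀ τ : Ω → ℝ≥0, IsExerciseTime ℱ t T τ → valueOfExercise Q ℱ r g t τ ≤ᵐ[Q] C
  le_of_value_le : ∀ Y : Ω → ℝ≥0∞, Measurable[ℱ t] Y →
    (∀ τ : Ω → ℝ≥0, IsExerciseTime ℱ t T τ → valueOfExercise Q ℱ r g t τ ≤ᵐ[Q] Y) → C ≤ᵐ[Q] Y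

/-- The exercise policy `τ` is optimal at time `t`: its value is the American price. -/
def IsOptimalExercise {Ω : Type*} {mΩ : MeasurableSpace Ω} (Q : Measure Ω)
    (ℱ : Filtration ℝ≥0 mΩ) (r : ℝ) (g : ℝ≥0 → Ω → ℝ) (T t : ℝ≥0) (τ : Ω → ℝ≥0) : Prop :=
  IsAmericanPrice Q ℱ r g T t (valueOfExercise Q ℱ r g t τ)

end

/-! Write `X_t = W_t + tRλ`, a Brownian motion under `Q`. With `θ_i = σ_i b_i`, the discounted
wealth of each rebalancing rule is the stochastic exponential `exp(θ'X_t - θ'Rθ t/2)`, a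
`Q`-martingale. Completing the square in `θ` gives both the maximum over `θ` and a Gaussian profile
around it, so integrating over `θ` against Lebesgue measure yields `t^(-n/2)` times the maximum, up
to a constant independent of `t` and of the path (`lintegral_stochExp_mixture`). By Tonelli the
mixture inherits the martingale identity, hence so does `M_t = t^(-n/2) e^(-rt) V_t^*` for `t > 0`
(`setLIntegral_deflatedMax`).

The discounted payoff is therefore an increasing deterministic weight `u^(n/2)` times the martingale
`M_u`. At the horizon this gives the European price `e^(rt) T^(n/2) M_t`. For a stopping time `τ ≤
T`, replacing `τ^(n/2)` by `T^(n/2)` only raises the payoff, and optional stopping bounds the result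
by the European price. Equality forces the two weights to agree almost surely, that is, `τ = T`,
because `M` is positive and the weight strictly increasing.

Since Lebesgue measure is infinite, `M` has infinite mean. The argument thus runs on `[0, ∞]`-valued
integrals over `ℱ t`-measurable sets, with a truncation where finiteness is needed. -/

noncomputable section

/-! ### Exponential moments of Gaussian vectors and exponential martingales -/

/-- The moment generating function of a centred multivariate Gaussian. -/
theorem lintegral_exp_multivariateGaussian {n : ℕ} {S : Matrix (Fin n) (Fin n) ℝ}
    (hS : S.PosSemidef) (α : Fin n → ℝ) :
    ∫⁻ x, ENNReal.ofReal (Real.exp (α ⬝ᵥ x.ofLp)) ∂multivariateGaussian 0 S =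
      ENNReal.ofReal (Real.exp (α ⬝ᵥ S *ᵥ α / 2)) := by
  set L : StrongDual ℝ (EuclideanSpace ℝ (Fin n)) := innerSL ℝ (WithLp.toLp 2 α) with hL
  have hLx : ∀ x : EuclideanSpace ℝ (Fin n), L x = α ⬝ᵥ x.ofLp := by
    intro x
    simp [hL, PiLp.inner_apply, dotProduct, mul_comm]
  have hvar : Var[L; multivariateGaussian 0 S] = α ⬝ᵥ S *ᵥ α := by
    have := covarianceBilin_multivariateGaussian (μ := 0) hS (WithLp.toLp 2 α) (WithLp.toLp 2 α)
    rw [covarianceBilin_self IsGaussian.memLp_two_id] at this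
    exact this
  have hmean : (multivariateGaussian (0 : EuclideanSpace ℝ (Fin n)) S)[L] = 0 := by
    rw [ContinuousLinearMap.integral_comp_id_comm IsGaussian.integrable_id]
    simp
  have hmap := IsGaussian.map_eq_gaussianReal (μ := multivariateGaussian 0 S) L
  rw [hmean, hvar] at hmap
  have h0 : 0 ≤ α ⬝ᵥ S *ᵥ α := by simpa using hS.dotProduct_mulVec_nonneg α
  simp_rw [← hLx]
  rw [← lintegral_map (f := fun y : ℝ => ENNReal.ofReal (Real.exp y)) (by fun_prop) (by fun_prop),
    hmap, ← ofReal_integral_eq_lintegral_ofReal]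
  · have := mgf_gaussianReal (p := gaussianReal 0 (α ⬝ᵥ S *ᵥ α).toNNReal) (X := id) (μ := 0)
      (v := (α ⬝ᵥ S *ᵥ α).toNNReal) (by simp) 1
    simp only [mgf, id, one_mul] at this
    rw [this]
    simp [h0, hLx]
  · simpa using integrable_exp_mul_gaussianReal (μ := 0) (v := (α ⬝ᵥ S *ᵥ α).toNNReal) 1
  · exact .of_forall fun x => (Real.exp_pos _).le

/-- The stochastic exponential of `θ ⬝ᵥ X` at time `t`, as a function of the position `x` of the
Brownian motion `X` with instantaneous covariance matrix `R`. -/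
def stochExp {n : ℕ} (R : Matrix (Fin n) (Fin n) ℝ) (θ : Fin n → ℝ) (t : ℝ≥0) (x : Fin n → ℝ) : ℝ :=
  Real.exp (θ ⬝ᵥ x - (θ ⬝ᵥ R *ᵥ θ) / 2 * t)

theorem stochExp_pos {n : ℕ} (R : Matrix (Fin n) (Fin n) ℝ) (θ : Fin n → ℝ) (t : ℝ≥0)
    (x : Fin n → ℝ) : 0 < stochExp R θ t x :=
  Real.exp_pos _

namespace IsCorrelatedBrownian

variable {Ω : Type*} {mΩ : MeasurableSpace Ω} {n : ℕ} {R : Matrix (Fin n) (Fin n) ℝ}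
  {ℱ : Filtration ℝ≥0 mΩ} {W : ℝ≥0 → Ω → EuclideanSpace ℝ (Fin n)} {P : Measure Ω}

theorem measurable_stochExp (hW : IsCorrelatedBrownian R ℱ W P) (α : Fin n → ℝ) (t : ℝ≥0) :
    Measurable[ℱ t] fun ω => ENNReal.ofReal (stochExp R α t (W t ω).ofLp) := by
  have h : Measurable fun x : EuclideanSpace ℝ (Fin n) =>
      ENNReal.ofReal (stochExp R α t x.ofLp) := by
    unfold stochExp dotProduct
    fun_prop
  exact h.comp (hW.adapted t)

/-- Stochastic exponentials of Brownian motion are martingales. -/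
theorem setLIntegral_stochExp (hW : IsCorrelatedBrownian R ℱ W P) (hR : R.PosSemidef)
    (α : Fin n → ℝ) {s u : ℝ≥0} (hsu : s ≤ u) {A : Set Ω} (hA : MeasurableSet[ℱ s] A) :
    ∫⁻ ω in A, ENNReal.ofReal (stochExp R α u (W u ω).ofLp) ∂P =
      ∫⁻ ω in A, ENNReal.ofReal (stochExp R α s (W s ω).ofLp) ∂P := by
  have hA' := ℱ.le s A hA
  have hnn : (0 : ℝ) ≤ (u : ℝ) - s := sub_nonneg.2 (by exact_mod_cast hsu)
  set c : ℝ := (α ⬝ᵥ R *ᵥ α) / 2 * ((u : ℝ) - s) with hc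
  -- The ratio of the exponentials at times `u` and `s` depends only on the increment; `c` is the
  -- log-moment that normalizes its mean to one.
  have hlaw : ∫⁻ ω, ENNReal.ofReal (Real.exp (α ⬝ᵥ (W u ω - W s ω).ofLp - c)) ∂P = 1 := by
    have h1 := (hW.law_increment s u hsu).lintegral_comp
      (f := fun x => ENNReal.ofReal (Real.exp (α ⬝ᵥ x.ofLp - c)))
      (by unfold dotProduct; fun_prop)
    rw [h1]
    have h2 : ∀ x : EuclideanSpace ℝ (Fin n), ENNReal.ofReal (Real.exp (α ⬝ᵥ x.ofLp - c)) =
        ENNReal.ofReal (Real.exp (α ⬝ᵥ x.ofLp)) * ENNReal.ofReal (Real.exp (-c)) := fun x => by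
      rw [← ENNReal.ofReal_mul (Real.exp_pos _).le, ← Real.exp_add, sub_eq_add_neg]
    simp_rw [h2]
    rw [lintegral_mul_const' _ _ ENNReal.ofReal_ne_top,
      lintegral_exp_multivariateGaussian (hR.smul hnn), ← ENNReal.ofReal_mul (Real.exp_pos _).le,
      ← Real.exp_add, Matrix.smul_mulVec, dotProduct_smul, smul_eq_mul, hc]
    ring_nf
    simp
  have hsplit : ∀ ω, A.indicator (fun ω => ENNReal.ofReal (stochExp R α u (W u ω).ofLp)) ω =
      A.indicator (fun ω => ENNReal.ofReal (stochExp R α s (W s ω).ofLp)) ω *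
        ENNReal.ofReal (Real.exp (α ⬝ᵥ (W u ω - W s ω).ofLp - c)) := by
    intro ω
    by_cases h : ω ∈ A
    · simp only [Set.indicator_of_mem h, stochExp]
      rw [← ENNReal.ofReal_mul (Real.exp_pos _).le, ← Real.exp_add, WithLp.ofLp_sub,
        dotProduct_sub, hc]
      ring_nf
    · simp [Set.indicator_of_notMem h]
  rw [← lintegral_indicator hA', ← lintegral_indicator hA']
  simp_rw [hsplit]
  have hfm : Measurable[ℱ s]
      (A.indicator fun ω => ENNReal.ofReal (stochExp R α s (W s ω).ofLp)) :=
    (hW.measurable_stochExp α s).indicator hA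
  have hinc : Measurable fun ω => W u ω - W s ω :=
    ((hW.adapted u).mono (ℱ.le u) le_rfl).sub ((hW.adapted s).mono (ℱ.le s) le_rfl)
  have hgm : Measurable[MeasurableSpace.comap (fun ω => W u ω - W s ω) inferInstance]
      (fun ω => ENNReal.ofReal (Real.exp (α ⬝ᵥ (W u ω - W s ω).ofLp - c))) := by
    have h : Measurable fun x : EuclideanSpace ℝ (Fin n) =>
        ENNReal.ofReal (Real.exp (α ⬝ᵥ x.ofLp - c)) := by
      unfold dotProduct
      fun_prop
    exact h.comp (comap_measurable _)
  have key := lintegral_mul_eq_lintegral_mul_lintegral_of_independent_measurableSpace (ℱ.le s)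
    hinc.comap_le (hW.indep_past s u hsu).symm hfm hgm
  simp only at key
  rw [key, hlaw, mul_one]

theorem lintegral_stochExp [IsProbabilityMeasure P] (hW : IsCorrelatedBrownian R ℱ W P)
    (hR : R.PosSemidef) (α : Fin n → ℝ) (u : ℝ≥0) :
    ∫⁻ ω, ENNReal.ofReal (stochExp R α u (W u ω).ofLp) ∂P = 1 := by
  have h := hW.setLIntegral_stochExp hR α (zero_le (a := u)) MeasurableSet.univ
  rw [Measure.restrict_univ] at h
  rw [h, lintegral_congr_ae (g := fun _ => 1)]
  · simp
  · filter_upwards [hW.start_zero] with ω hω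
    simp [stochExp, hω]

end IsCorrelatedBrownian

/-! ### Gaussian integrals over the exponent and the mixture of exponentials -/

section QuadraticForm

variable {n : ℕ} {R : Matrix (Fin n) (Fin n) ℝ}

theorem Matrix.IsSymm.dotProduct_mulVec_comm (hR : R.IsSymm) (a b : Fin n → ℝ) :
    a ⬝ᵥ R *ᵥ b = b ⬝ᵥ R *ᵥ a := by
  rw [Matrix.dotProduct_mulVec, ← Matrix.mulVec_transpose, hR.eq, dotProduct_comm]

/-- The exponent `θ` that maximizes `stochExp R θ t x`. -/
def stochExpArgmax (R : Matrix (Fin n) (Fin n) ℝ) (t : ℝ≥0) (x : Fin n → ℝ) : Fin n → ℝ :=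
  (t : ℝ)⁻¹ • (R⁻¹ *ᵥ x)

/-- The largest value of `stochExp R θ t x` over all `θ`. -/
def maxStochExp (R : Matrix (Fin n) (Fin n) ℝ) (t : ℝ≥0) (x : Fin n → ℝ) : ℝ :=
  stochExp R (stochExpArgmax R t x) t x

/-- Completing the square: once `x = tRc` with `c` the critical point, the exponent is a quadratic
polynomial in `θ` centred at `c`. The exact remainder, not just the maximum, is what the mixture
integral needs. -/
theorem stochExp_eq_maxStochExp_mul (hR : R.IsSymm) (hRu : IsUnit R) {t : ℝ≥0} (ht : 0 < t)
    (x θ : Fin n → ℝ) :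
    stochExp R θ t x = maxStochExp R t x *
      Real.exp (-((θ - stochExpArgmax R t x) ⬝ᵥ R *ᵥ (θ - stochExpArgmax R t x)) / 2 * t) := by
  have ht' : (t : ℝ) ≠ 0 := by exact_mod_cast ht.ne'
  have hx : x = (t : ℝ) • (R *ᵥ stochExpArgmax R t x) := by
    rw [stochExpArgmax, Matrix.mulVec_smul, smul_smul, mul_inv_cancel₀ ht', one_smul,
      Matrix.mulVec_mulVec, Matrix.mul_nonsing_inv _ ((Matrix.isUnit_iff_isUnit_det R).1 hRu),
      Matrix.one_mulVec]
  unfold maxStochExp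
  generalize stochExpArgmax R t x = c at hx ⊢
  subst hx
  rw [stochExp, stochExp, ← Real.exp_add]
  congr 1
  simp only [dotProduct_smul, Matrix.mulVec_sub, dotProduct_sub, sub_dotProduct, smul_eq_mul,
    hR.dotProduct_mulVec_comm c θ]
  ring

theorem stochExp_le_maxStochExp (hR : R.PosSemidef) (hRu : IsUnit R) {t : ℝ≥0} (ht : 0 < t)
    (x θ : Fin n → ℝ) : stochExp R θ t x ≤ maxStochExp R t x := by
  have hsymm : R.IsSymm := by simpa using hR.isHermitian
  rw [stochExp_eq_maxStochExp_mul hsymm hRu ht]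
  refine mul_le_of_le_one_right (stochExp_pos _ _ _ _).le (Real.exp_le_one_iff.2 ?_)
  have h := hR.dotProduct_mulVec_nonneg (θ - stochExpArgmax R t x)
  rw [star_trivial] at h
  have h2 := mul_nonneg h t.coe_nonneg
  linarith

/-- The Gaussian integral of the quadratic form of `R`. -/
def gaussianMass (R : Matrix (Fin n) (Fin n) ℝ) : ℝ≥0∞ :=
  ∫⁻ θ : Fin n → ℝ, ENNReal.ofReal (Real.exp (-(θ ⬝ᵥ R *ᵥ θ) / 2))

/-- Together with finiteness, this allows the constant to be cancelled in `[0, ∞]`; its explicit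
value is never needed. -/
theorem gaussianMass_ne_zero (R : Matrix (Fin n) (Fin n) ℝ) : gaussianMass R ≠ 0 := by
  rw [gaussianMass, Ne, lintegral_eq_zero_iff (by unfold dotProduct Matrix.mulVec dotProduct; fun_prop)]
  intro h
  have : (volume : Measure (Fin n → ℝ)) = 0 := by
    rw [← ae_eq_bot, ← Filter.eventually_false_iff_eq_bot]
    filter_upwards [h] with θ hθ
    have := Real.exp_pos (-(θ ⬝ᵥ R *ᵥ θ) / 2)
    simp at hθ
    linarith
  exact NeZero.ne _ this

theorem gaussianMass_one_ne_top : gaussianMass (1 : Matrix (Fin n) (Fin n) ℝ) ≠ ∞ := by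
  have h : Integrable fun θ : Fin n → ℝ => ∏ i, Real.exp (-(1 / 2) * θ i ^ 2) :=
    Integrable.fintype_prod fun i => integrable_exp_neg_mul_sq (by norm_num)
  refine ne_of_eq_of_ne (lintegral_congr fun θ => ?_) h.lintegral_lt_top.ne
  rw [← Real.exp_sum, Matrix.one_mulVec, dotProduct, ← Finset.mul_sum]
  congr 2
  rw [Finset.sum_congr rfl fun i _ => (pow_two (θ i)).symm]
  ring

theorem lintegral_comp_linearMap {f : (Fin n → ℝ) →ₗ[ℝ] (Fin n → ℝ)} (hf : LinearMap.det f ≠ 0)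
    {g : (Fin n → ℝ) → ℝ≥0∞} (hg : Measurable g) :
    ∫⁻ θ, g (f θ) = ENNReal.ofReal |(LinearMap.det f)⁻¹| * ∫⁻ θ, g θ := by
  have hfm : Measurable f := f.continuous_of_finiteDimensional.measurable
  rw [← lintegral_map hg hfm, Measure.map_linearMap_addHaar_eq_smul_addHaar volume hf,
    lintegral_smul_measure, smul_eq_mul]

/-- Factoring `R = Bᴴ * B` and substituting `Bθ` reduces to the standard Gaussian integral; `B` is
invertible because `R` is. -/
theorem gaussianMass_ne_top (hR : R.PosSemidef) (hRu : IsUnit R) : gaussianMass R ≠ ∞ := by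
  obtain ⟨B, rfl⟩ : ∃ B : Matrix (Fin n) (Fin n) ℝ, R = Bᴴ * B := by
    open scoped MatrixOrder Matrix.Norms.L2Operator in
    exact CStarAlgebra.nonneg_iff_eq_star_mul_self.1 hR.nonneg
  have hB : B.det ≠ 0 := by
    intro h
    have := ((Matrix.isUnit_iff_isUnit_det _).1 hRu).ne_zero
    rw [Matrix.det_mul, h, mul_zero] at this
    exact this rfl
  have hmeas : Measurable fun θ : Fin n → ℝ =>
      ENNReal.ofReal (Real.exp (-(θ ⬝ᵥ (1 : Matrix (Fin n) (Fin n) ℝ) *ᵥ θ) / 2)) := by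
    unfold dotProduct Matrix.mulVec dotProduct
    fun_prop
  have h := lintegral_comp_linearMap (f := Matrix.toLin' B) (by rwa [LinearMap.det_toLin']) hmeas
  have h2 : gaussianMass (Bᴴ * B) = _ := (lintegral_congr fun θ => ?_).trans h
  · rw [h2]
    exact ENNReal.mul_ne_top ENNReal.ofReal_ne_top gaussianMass_one_ne_top
  · rw [Matrix.toLin'_apply, Matrix.one_mulVec, ← Matrix.mulVec_mulVec, Matrix.dotProduct_mulVec θ,
      Matrix.conjTranspose_eq_transpose_of_trivial,
      Matrix.vecMul_transpose]

/-- The substitution `√t θ` has Jacobian `t^(n/2)`, which is the origin of the exponent in the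
price. -/
theorem lintegral_exp_quadraticForm (R : Matrix (Fin n) (Fin n) ℝ) {t : ℝ≥0} (ht : 0 < t) :
    ∫⁻ θ : Fin n → ℝ, ENNReal.ofReal (Real.exp (-(θ ⬝ᵥ R *ᵥ θ) / 2 * t)) =
      ENNReal.ofReal ((t : ℝ) ^ (-((n : ℝ) / 2))) * gaussianMass R := by
  have ht' : (0 : ℝ) < t := by exact_mod_cast ht
  have hmeas : Measurable fun θ : Fin n → ℝ =>
      ENNReal.ofReal (Real.exp (-(θ ⬝ᵥ R *ᵥ θ) / 2)) := by
    unfold dotProduct Matrix.mulVec dotProduct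
    fun_prop
  have hdet : LinearMap.det ((√(t : ℝ)) • (LinearMap.id : (Fin n → ℝ) →ₗ[ℝ] (Fin n → ℝ))) =
      (t : ℝ) ^ ((n : ℝ) / 2) := by
    rw [LinearMap.det_smul, LinearMap.det_id, mul_one, Module.finrank_fin_fun, Real.sqrt_eq_rpow,
      ← Real.rpow_natCast, ← Real.rpow_mul ht'.le]
    ring_nf
  have hpos : 0 < (t : ℝ) ^ ((n : ℝ) / 2) := Real.rpow_pos_of_pos ht' _
  have h := lintegral_comp_linearMap (by rw [hdet]; exact hpos.ne') hmeas
  rw [hdet, ← Real.rpow_neg ht'.le, abs_of_pos (Real.rpow_pos_of_pos ht' _)] at h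
  rw [gaussianMass, ← h]
  refine lintegral_congr fun θ => ?_
  simp only [LinearMap.smul_apply, LinearMap.id_apply, Matrix.mulVec_smul, dotProduct_smul,
    smul_dotProduct, smul_eq_mul]
  rw [← mul_assoc, Real.mul_self_sqrt ht'.le]
  ring_nf

/-- The uniform mixture of all stochastic exponentials (the universal portfolio) is a multiple of
the best of them. -/
theorem lintegral_stochExp_mixture (hR : R.PosSemidef) (hRu : IsUnit R) {t : ℝ≥0} (ht : 0 < t)
    (x : Fin n → ℝ) :
    ∫⁻ θ, ENNReal.ofReal (stochExp R θ t x) =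
      ENNReal.ofReal ((t : ℝ) ^ (-((n : ℝ) / 2)) * maxStochExp R t x) * gaussianMass R := by
  have hsymm : R.IsSymm := by simpa using hR.isHermitian
  have hm : 0 ≤ maxStochExp R t x := (stochExp_pos _ _ _ _).le
  simp_rw [stochExp_eq_maxStochExp_mul hsymm hRu ht x, ENNReal.ofReal_mul hm]
  -- Translation invariance of Lebesgue measure removes the maximizer, so the remaining factor no
  -- longer depends on the path.
  rw [lintegral_const_mul' _ _ ENNReal.ofReal_ne_top,
    lintegral_sub_right_eq_self (μ := volume) (fun θ : Fin n → ℝ =>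
      ENNReal.ofReal (Real.exp (-(θ ⬝ᵥ R *ᵥ θ) / 2 * t))) (stochExpArgmax R t x),
    lintegral_exp_quadraticForm R ht, ENNReal.ofReal_mul (by positivity)]
  ring

end QuadraticForm

/-! ### Optional stopping for nonnegative martingales without integrability -/

section OptionalStopping

variable {Ω : Type*} {mΩ : MeasurableSpace Ω} {Q : Measure Ω} {ℱ : Filtration ℝ≥0 mΩ}
  {t T : ℝ≥0} {τ : Ω → ℝ≥0}

/-- The `j`-th point of the grid with mesh `(k + 1)⁻¹`, cut off at `T`. -/
def gridPoint (T : ℝ≥0) (k j : ℕ) : ℝ≥0 := min T (j / (k + 1))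

/-- The index of the first point of the grid with mesh `(k + 1)⁻¹` that is at least `u`. -/
def gridIndex (k : ℕ) (u : ℝ≥0) : ℕ := ⌈u * (k + 1)⌉₊

theorem measurable_gridIndex (k : ℕ) : Measurable (gridIndex k) :=
  Nat.measurable_ceil.comp (by fun_prop)

theorem le_gridPoint_gridIndex (k : ℕ) {u : ℝ≥0} (hu : u ≤ T) :
    u ≤ gridPoint T k (gridIndex k u) := by
  refine le_min hu ?_
  rw [le_div_iff₀ (by positivity)]
  exact Nat.le_ceil _

theorem tendsto_gridPoint_gridIndex {u : ℝ≥0} (hu : u ≤ T) :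
    Filter.Tendsto (fun k => gridPoint T k (gridIndex k u)) Filter.atTop (nhds u) := by
  have hup : Filter.Tendsto (fun k : ℕ => u + 1 / ((k : ℝ≥0) + 1)) Filter.atTop (nhds u) := by
    have h : Filter.Tendsto (fun k : ℕ => 1 / ((k : ℝ≥0) + 1)) Filter.atTop (nhds 0) :=
      tendsto_one_div_add_atTop_nhds_zero_nat
    simpa using tendsto_const_nhds.add h
  refine tendsto_of_tendsto_of_tendsto_of_le_of_le tendsto_const_nhds hup
    (fun k => le_gridPoint_gridIndex k hu) fun k => (min_le_right _ _).trans ?_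
  have hk : (0 : ℝ≥0) < (k : ℝ≥0) + 1 := by positivity
  rw [div_le_iff₀ hk, add_mul, one_div, inv_mul_cancel₀ hk.ne']
  exact (Nat.ceil_lt_add_one (zero_le)).le

/-- A stopping time cut off at `s` is known at time `s`. -/
theorem IsExerciseTime.measurable_min (hτ : IsExerciseTime ℱ t T τ) (s : ℝ≥0) :
    Measurable[ℱ s] fun ω => min (τ ω) s := by
  refine measurable_of_Iic fun a => ?_
  have h : (fun ω => min (τ ω) s) ⁻¹' Set.Iic a = {ω | τ ω ≤ a} ∪ {_ω | s ≤ a} := by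
    ext ω
    simp
  rw [h]
  by_cases hsa : s ≤ a
  · simp [hsa]
  · have h2 := hτ.isStoppingTime a
    simp only [WithTop.coe_le_coe] at h2
    simpa [hsa] using ℱ.mono (le_of_not_ge hsa) _ h2

theorem IsExerciseTime.measurable (hτ : IsExerciseTime ℱ t T τ) : Measurable τ := by
  have h := (hτ.measurable_min T).mono (ℱ.le T) le_rfl
  simpa only [min_eq_left (hτ.le_expiry _)] using h

/-- Rounding is upwards, so on this event `τ` has already occurred by the grid point, and the event
can be read off from `τ` cut off there. -/
theorem IsExerciseTime.measurableSet_gridIndex_eq (hτ : IsExerciseTime ℱ t T τ) (k j : ℕ) :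
    MeasurableSet[ℱ (gridPoint T k j)] {ω | gridIndex k (τ ω) = j} := by
  set s := gridPoint T k j with hs
  have h : {ω | gridIndex k (τ ω) = j} =
      {ω | τ ω ≤ s} ∩ {ω | gridIndex k (min (τ ω) s) = j} := by
    ext ω
    simp only [Set.mem_ofPred_eq, Set.mem_inter_iff]
    constructor
    · intro hj
      have hle : τ ω ≤ s := by
        rw [hs, ← hj]
        exact le_gridPoint_gridIndex k (hτ.le_expiry ω)
      exact ⟨hle, by rwa [min_eq_left hle]⟩
    · rintro ⟨hle, hj⟩
      rwa [min_eq_left hle] at hj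
  rw [h]
  have h1 := hτ.isStoppingTime s
  simp only [WithTop.coe_le_coe] at h1
  exact h1.inter ((measurable_gridIndex k).comp (hτ.measurable_min s)
    (measurableSet_singleton j))

variable {M : ℝ≥0 → Ω → ℝ≥0∞}

theorem measurable_uncurry_gridPoint (hM : ∀ s, Measurable (M s)) (k : ℕ) :
    Measurable fun p : ℕ × Ω => M (gridPoint T k p.1) p.2 := by
  refine measurable_from_prod_countable_right fun j => ?_
  dsimp only
  exact hM _

theorem measurable_gridStopped (hτ : IsExerciseTime ℱ t T τ) (hM : ∀ s, Measurable (M s)) (k : ℕ) :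
    Measurable fun ω => M (gridPoint T k (gridIndex k (τ ω))) ω := by
  have h2 : Measurable fun ω => (gridIndex k (τ ω), ω) :=
    ((measurable_gridIndex k).comp hτ.measurable).prodMk measurable_id
  have h := (measurable_uncurry_gridPoint (T := T) hM k).comp h2
  exact h

theorem tendsto_gridStopped (hτ : IsExerciseTime ℱ t T τ) {ω : Ω}
    (hc : ContinuousOn (fun s => M s ω) (Set.Icc t T)) :
    Filter.Tendsto (fun k => M (gridPoint T k (gridIndex k (τ ω))) ω) Filter.atTop
      (nhds (M (τ ω) ω)) := by
  refine (hc (τ ω) ⟨hτ.ge_start ω, hτ.le_expiry ω⟩).tendsto.comp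
    (tendsto_nhdsWithin_iff.2 ⟨tendsto_gridPoint_gridIndex (hτ.le_expiry ω), ?_⟩)
  exact .of_forall fun k => ⟨(hτ.ge_start ω).trans (le_gridPoint_gridIndex k (hτ.le_expiry ω)),
    min_le_left _ _⟩

theorem aemeasurable_stopped (hτ : IsExerciseTime ℱ t T τ) (hM : ∀ s, Measurable (M s))
    (hc : ∀ᵐ ω ∂Q, ContinuousOn (fun s => M s ω) (Set.Icc t T)) :
    AEMeasurable (fun ω => M (τ ω) ω) Q := by
  refine aemeasurable_of_tendsto_metrizable_ae Filter.atTop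
    (fun k => (measurable_gridStopped hτ hM k).aemeasurable) ?_
  filter_upwards [hc] with ω hω
  exact tendsto_gridStopped hτ hω

/-- On each cell of the partition by grid index the stopping time is deterministic, so the
martingale identity between that time and `T` applies. Countable additivity reassembles the cells,
with no integrability required. -/
theorem setLIntegral_gridStopped (hτ : IsExerciseTime ℱ t T τ) (htT : t ≤ T)
    (hmart : ∀ s, t ≤ s → s ≤ T → ∀ A, MeasurableSet[ℱ s] A →
      ∫⁻ ω in A, M T ω ∂Q = ∫⁻ ω in A, M s ω ∂Q)
    {A : Set Ω} (hA : MeasurableSet[ℱ t] A) (k : ℕ) :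
    ∫⁻ ω in A, M (gridPoint T k (gridIndex k (τ ω))) ω ∂Q = ∫⁻ ω in A, M t ω ∂Q := by
  have hB : ∀ j, MeasurableSet {ω | gridIndex k (τ ω) = j} := fun j =>
    ℱ.le _ _ (hτ.measurableSet_gridIndex_eq k j)
  have hAB : ∀ j, MeasurableSet (A ∩ {ω | gridIndex k (τ ω) = j}) := fun j =>
    (ℱ.le t A hA).inter (hB j)
  have hdisj : Pairwise (Function.onFun Disjoint fun j => A ∩ {ω | gridIndex k (τ ω) = j}) := by
    intro i j hij
    refine Set.disjoint_left.2 fun ω hi hj => hij ?_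
    exact hi.2.symm.trans hj.2
  have hU : A = ⋃ j, A ∩ {ω | gridIndex k (τ ω) = j} := by
    ext ω
    simp
  rw [← hmart t le_rfl htT A hA, hU, lintegral_iUnion hAB hdisj, lintegral_iUnion hAB hdisj]
  refine tsum_congr fun j => ?_
  have h1 : ∫⁻ ω in A ∩ {ω | gridIndex k (τ ω) = j},
      M (gridPoint T k (gridIndex k (τ ω))) ω ∂Q =
      ∫⁻ ω in A ∩ {ω | gridIndex k (τ ω) = j}, M (gridPoint T k j) ω ∂Q :=
    setLIntegral_congr_fun (hAB j) fun ω hω => by rw [hω.2]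
  rw [h1]
  by_cases hts : t ≤ gridPoint T k j
  · exact (hmart _ hts (min_le_left _ _) _
      ((ℱ.mono hts A hA).inter (hτ.measurableSet_gridIndex_eq k j))).symm
  · have hempty : A ∩ {ω | gridIndex k (τ ω) = j} = ∅ := by
      refine Set.eq_empty_of_forall_notMem fun ω hω => hts ?_
      rw [← hω.2]
      exact (hτ.ge_start ω).trans (le_gridPoint_gridIndex k (hτ.le_expiry ω))
    simp [hempty]

/-- Optional stopping for a nonnegative, not necessarily integrable, martingale with continuous
paths. -/
theorem setLIntegral_stopped_le (hτ : IsExerciseTime ℱ t T τ) (htT : t ≤ T)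
    (hM : ∀ s, Measurable (M s))
    (hmart : ∀ s, t ≤ s → s ≤ T → ∀ A, MeasurableSet[ℱ s] A →
      ∫⁻ ω in A, M T ω ∂Q = ∫⁻ ω in A, M s ω ∂Q)
    (hc : ∀ᵐ ω ∂Q, ContinuousOn (fun s => M s ω) (Set.Icc t T))
    {A : Set Ω} (hA : MeasurableSet[ℱ t] A) :
    ∫⁻ ω in A, M (τ ω) ω ∂Q ≤ ∫⁻ ω in A, M t ω ∂Q := by
  -- The roundings decrease to `τ` in the limit, and Fatou's lemma passes from the equality on the
  -- grid to an inequality for `τ`. Only this direction is needed for an upper bound on the price.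
  calc ∫⁻ ω in A, M (τ ω) ω ∂Q
      = ∫⁻ ω in A, Filter.liminf (fun k => M (gridPoint T k (gridIndex k (τ ω))) ω)
          Filter.atTop ∂Q := by
        refine setLIntegral_congr_fun_ae (ℱ.le t A hA) ?_
        filter_upwards [hc] with ω hω _
        exact (tendsto_gridStopped hτ hω).liminf_eq.symm
    _ ≤ Filter.liminf (fun k => ∫⁻ ω in A, M (gridPoint T k (gridIndex k (τ ω))) ω ∂Q)
          Filter.atTop := lintegral_liminf_le (measurable_gridStopped hτ hM)
    _ = ∫⁻ ω in A, M t ω ∂Q := by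
        simp_rw [setLIntegral_gridStopped hτ htT hmart hA]
        simp

end OptionalStopping

/-! ### Stopping an increasing weight times a martingale -/

section IncreasingWeight

variable {Ω : Type*} {mΩ : MeasurableSpace Ω} {Q : Measure Ω} {ℱ : Filtration ℝ≥0 mΩ}
  {t T : ℝ≥0} {τ : Ω → ℝ≥0} {M : ℝ≥0 → Ω → ℝ} {w : ℝ≥0 → ℝ}

/-- The discounted payoff of a martingale multiplied by a weight that increases in time is worth
most when it is collected at the horizon. -/
theorem setLIntegral_weighted_stopped_le (hτ : IsExerciseTime ℱ t T τ) (htT : t ≤ T)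
    (hM : ∀ s, Measurable (M s))
    (hmart : ∀ s, t ≤ s → s ≤ T → ∀ A, MeasurableSet[ℱ s] A →
      ∫⁻ ω in A, ENNReal.ofReal (M T ω) ∂Q = ∫⁻ ω in A, ENNReal.ofReal (M s ω) ∂Q)
    (hc : ∀ᵐ ω ∂Q, ContinuousOn (fun s => M s ω) (Set.Icc t T))
    (hw0 : 0 ≤ w T) {A : Set Ω} (hA : MeasurableSet[ℱ t] A) :
    ∫⁻ ω in A, ENNReal.ofReal (w T * M (τ ω) ω) ∂Q ≤
      ∫⁻ ω in A, ENNReal.ofReal (w T * M t ω) ∂Q := by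
  simp_rw [ENNReal.ofReal_mul hw0]
  rw [lintegral_const_mul' _ _ ENNReal.ofReal_ne_top, lintegral_const_mul' _ _ ENNReal.ofReal_ne_top]
  gcongr 1
  refine setLIntegral_stopped_le (M := fun s ω => ENNReal.ofReal (M s ω)) hτ htT
    (fun s => (hM s).ennreal_ofReal) hmart ?_ hA
  filter_upwards [hc] with ω hω
  exact ENNReal.continuous_ofReal.comp_continuousOn hω

theorem condLExp_weighted_horizon [IsProbabilityMeasure Q] (htT : t ≤ T)
    (hMt : Measurable[ℱ t] (M t))
    (hmart : ∀ s, t ≤ s → s ≤ T → ∀ A, MeasurableSet[ℱ s] A →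
      ∫⁻ ω in A, ENNReal.ofReal (M T ω) ∂Q = ∫⁻ ω in A, ENNReal.ofReal (M s ω) ∂Q)
    (hw0 : 0 ≤ w T) :
    condLExp (ℱ t) Q (fun ω => ENNReal.ofReal (w T * M T ω)) =ᵐ[Q]
      fun ω => ENNReal.ofReal (w T * M t ω) := by
  refine (ae_eq_condLExp (ℱ.le t) Q _ (hMt.const_mul _).ennreal_ofReal fun A hA => ?_).symm
  simp_rw [ENNReal.ofReal_mul hw0]
  rw [lintegral_const_mul' _ _ ENNReal.ofReal_ne_top, lintegral_const_mul' _ _ ENNReal.ofReal_ne_top,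
    hmart t le_rfl htT A hA]

theorem condLExp_weighted_stopped_le [IsProbabilityMeasure Q] (hτ : IsExerciseTime ℱ t T τ)
    (htT : t ≤ T) (hM : ∀ s, Measurable (M s)) (hMt : Measurable[ℱ t] (M t))
    (hM0 : ∀ s, t ≤ s → ∀ ω, 0 < M s ω)
    (hmart : ∀ s, t ≤ s → s ≤ T → ∀ A, MeasurableSet[ℱ s] A →
      ∫⁻ ω in A, ENNReal.ofReal (M T ω) ∂Q = ∫⁻ ω in A, ENNReal.ofReal (M s ω) ∂Q)
    (hc : ∀ᵐ ω ∂Q, ContinuousOn (fun s => M s ω) (Set.Icc t T))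
    (hw0 : 0 ≤ w T) (hw : StrictMono w) :
    condLExp (ℱ t) Q (fun ω => ENNReal.ofReal (w (τ ω) * M (τ ω) ω)) ≤ᵐ[Q]
      fun ω => ENNReal.ofReal (w T * M t ω) := by
  -- Both sides are `ℱ t`-measurable, so they can be compared under the restriction of `Q` to `ℱ t`,
  -- where only integrals over `ℱ t`-measurable sets have to be checked.
  refine ae_le_of_ae_le_trim (hm := ℱ.le t) (ae_le_of_forall_setLIntegral_le_of_sigmaFinite
    (μ := Q.trim (ℱ.le t)) (measurable_condLExp _ _ _) fun A hA _ => ?_)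
  rw [setLIntegral_condLExp_trim (ℱ.le t) _ _ hA,
    setLIntegral_trim (ℱ.le t) (hMt.const_mul _).ennreal_ofReal hA]
  refine le_trans (lintegral_mono fun ω => ?_)
    (setLIntegral_weighted_stopped_le hτ htT hM hmart hc hw0 hA)
  exact ENNReal.ofReal_le_ofReal
    (mul_le_mul_of_nonneg_right (hw.monotone (hτ.le_expiry ω)) (hM0 _ (hτ.ge_start ω) _).le)

/-- The payoff with weight `w T` lies above the actual payoff but, by optional stopping, integrates
to no more than the optimal value. If the actual payoff attains that value, the two payoffs coincide
almost surely, and positivity of `M` leaves only `τ = T`. -/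
theorem eq_horizon_of_condLExp_weighted_eq [IsProbabilityMeasure Q] (hτ : IsExerciseTime ℱ t T τ)
    (htT : t ≤ T) (hM : ∀ s, Measurable (M s)) (hMt : Measurable[ℱ t] (M t))
    (hM0 : ∀ s, t ≤ s → ∀ ω, 0 < M s ω)
    (hmart : ∀ s, t ≤ s → s ≤ T → ∀ A, MeasurableSet[ℱ s] A →
      ∫⁻ ω in A, ENNReal.ofReal (M T ω) ∂Q = ∫⁻ ω in A, ENNReal.ofReal (M s ω) ∂Q)
    (hc : ∀ᵐ ω ∂Q, ContinuousOn (fun s => M s ω) (Set.Icc t T))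
    (hw0 : 0 < w T) (hw : StrictMono w)
    (hopt : condLExp (ℱ t) Q (fun ω => ENNReal.ofReal (w (τ ω) * M (τ ω) ω)) =ᵐ[Q]
      fun ω => ENNReal.ofReal (w T * M t ω)) :
    ∀ᵐ ω ∂Q, τ ω = T := by
  have hMτ : AEMeasurable (fun ω => ENNReal.ofReal (w T * M (τ ω) ω)) Q := by
    have h := aemeasurable_stopped (Q := Q) (M := fun s ω => ENNReal.ofReal (w T * M s ω)) hτ
      (fun s => ((hM s).const_mul _).ennreal_ofReal) ?_
    · exact h
    · filter_upwards [hc] with ω hω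
      exact ENNReal.continuous_ofReal.comp_continuousOn (hω.const_mul _)
  have hstep : ∀ k : ℕ, ∀ᵐ ω ∂Q, M t ω ≤ k → τ ω = T := by
    intro k
    -- Equal integrals of ordered functions force almost sure equality only when they are finite.
    -- Restricting to a set known at time `t` on which `M t` is bounded secures this; these sets
    -- exhaust `Ω` as `k` grows.
    set A : Set Ω := {ω | M t ω ≤ k}
    have hA : MeasurableSet[ℱ t] A := hMt measurableSet_Iic
    have hA' : MeasurableSet A := ℱ.le t A hA
    have hval : ∫⁻ ω in A, ENNReal.ofReal (w (τ ω) * M (τ ω) ω) ∂Q =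
        ∫⁻ ω in A, ENNReal.ofReal (w T * M t ω) ∂Q := by
      rw [← setLIntegral_condLExp (ℱ.le t) Q _ hA]
      exact lintegral_congr_ae (ae_restrict_of_ae hopt)
    have hfin : ∫⁻ ω in A, ENNReal.ofReal (w T * M t ω) ∂Q ≠ ∞ := by
      refine ne_top_of_le_ne_top ?_ (setLIntegral_mono (g := fun _ => ENNReal.ofReal (w T * k))
        measurable_const fun ω hω => ENNReal.ofReal_le_ofReal
          (mul_le_mul_of_nonneg_left hω hw0.le))
      rw [setLIntegral_const]
      exact ENNReal.mul_ne_top ENNReal.ofReal_ne_top (measure_ne_top _ _)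
    have heq := ae_eq_of_ae_le_of_lintegral_le (μ := Q.restrict A)
      (f := fun ω => ENNReal.ofReal (w (τ ω) * M (τ ω) ω))
      (g := fun ω => ENNReal.ofReal (w T * M (τ ω) ω))
      (.of_forall fun ω => ENNReal.ofReal_le_ofReal
        (mul_le_mul_of_nonneg_right (hw.monotone (hτ.le_expiry ω)) (hM0 _ (hτ.ge_start ω) _).le))
      (by rwa [hval]) hMτ.restrict
      (by rw [hval]; exact setLIntegral_weighted_stopped_le hτ htT hM hmart hc hw0.le hA)
    filter_upwards [(ae_restrict_iff' hA').1 heq] with ω hω hωA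
    have h := hω hωA
    by_contra hne
    have hlt := mul_lt_mul_of_pos_right (hw (lt_of_le_of_ne (hτ.le_expiry ω) hne))
      (hM0 _ (hτ.ge_start ω) ω)
    exact (((ENNReal.ofReal_lt_ofReal_iff (mul_pos hw0 (hM0 _ (hτ.ge_start ω) _))).2 hlt).ne h)
  filter_upwards [ae_all_iff.2 hstep] with ω hω
  obtain ⟨k, hk⟩ := exists_nat_ge (M t ω)
  exact hω k hk

end IncreasingWeight

/-! ### The market under the risk-neutral measure -/

namespace GBMMarket

variable {Ω : Type*} {mΩ : MeasurableSpace Ω} {n : ℕ} (m : GBMMarket n)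
  (W : ℝ≥0 → Ω → EuclideanSpace ℝ (Fin n))

/-- The process that is a Brownian motion under the risk-neutral measure. -/
def riskNeutralBrownian (t : ℝ≥0) (ω : Ω) : Fin n → ℝ :=
  (W t ω).ofLp + (t : ℝ) • (m.R *ᵥ m.riskPremium)

theorem R_isSymm : m.R.IsSymm := by
  simpa using m.R_posSemidef.isHermitian

theorem R_mulVec_riskPremium (i : Fin n) :
    (m.R *ᵥ m.riskPremium) i = (m.μ i - m.r) / m.σ i := by
  rw [riskPremium, Matrix.mulVec_mulVec,
    Matrix.mul_nonsing_inv _ ((Matrix.isUnit_iff_isUnit_det _).1 m.R_isUnit), Matrix.one_mulVec]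

/-- The shift `tRλ` in the risk-neutral Brownian motion absorbs every excess drift `μ_i - r`, and
the substitution `θ_i = σ_i b_i` turns `Σ` into `R`. -/
theorem wealth_eq (b : Fin n → ℝ) (t : ℝ≥0) (ω : Ω) :
    m.wealth W b t ω = Real.exp (m.r * t) *
      stochExp m.R (fun i => m.σ i * b i) t (m.riskNeutralBrownian W t ω) := by
  have hcov : b ⬝ᵥ (m.cov *ᵥ b) =
      (fun i => m.σ i * b i) ⬝ᵥ m.R *ᵥ (fun i => m.σ i * b i) := by
    have h : Matrix.diagonal m.σ *ᵥ b = fun i => m.σ i * b i := by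
      ext i
      rw [Matrix.mulVec_diagonal]
    rw [cov, ← Matrix.mulVec_mulVec, ← Matrix.mulVec_mulVec, h]
    simp only [dotProduct, Matrix.mulVec_diagonal]
    exact Finset.sum_congr rfl fun i _ => by ring
  have hlin : (fun i => m.σ i * b i) ⬝ᵥ m.riskNeutralBrownian W t ω =
      (∑ i, (m.μ i - m.r) * b i) * t + ∑ i, b i * m.σ i * W t ω i := by
    rw [Finset.sum_mul, ← Finset.sum_add_distrib, dotProduct]
    refine Finset.sum_congr rfl fun i _ => ?_
    have := (m.σ_pos i).ne'
    simp only [riskNeutralBrownian, Pi.add_apply, Pi.smul_apply, smul_eq_mul,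
      R_mulVec_riskPremium]
    field_simp
    ring
  rw [wealth, stochExp, ← Real.exp_add, hcov, hlin]
  ring_nf

theorem isGreatest_wealth {t : ℝ≥0} (ht : 0 < t) (ω : Ω) :
    IsGreatest (Set.range fun b : Fin n → ℝ => m.wealth W b t ω)
      (Real.exp (m.r * t) * maxStochExp m.R t (m.riskNeutralBrownian W t ω)) := by
  constructor
  · refine ⟨fun i => stochExpArgmax m.R t (m.riskNeutralBrownian W t ω) i / m.σ i, ?_⟩
    have h : (fun i => m.σ i *
        (stochExpArgmax m.R t (m.riskNeutralBrownian W t ω) i / m.σ i)) =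
        stochExpArgmax m.R t (m.riskNeutralBrownian W t ω) :=
      funext fun i => mul_div_cancel₀ _ (m.σ_pos i).ne'
    simp only [wealth_eq, h, maxStochExp]
  · rintro _ ⟨b, rfl⟩
    simp only [wealth_eq]
    exact mul_le_mul_of_nonneg_left
      (stochExp_le_maxStochExp m.R_posSemidef m.R_isUnit ht _ _) (Real.exp_pos _).le

theorem hindsightWealth_eq {t : ℝ≥0} (ht : 0 < t) (ω : Ω) :
    m.hindsightWealth W t ω =
      Real.exp (m.r * t) * maxStochExp m.R t (m.riskNeutralBrownian W t ω) :=
  (m.isGreatest_wealth W ht ω).csSup_eq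

variable {m W} {ℱ : Filtration ℝ≥0 mΩ} {P : Measure Ω} {T : ℝ≥0}

theorem riskNeutral_eq :
    m.riskNeutral W P T = P.withDensity fun ω =>
      ENNReal.ofReal (stochExp m.R (-m.riskPremium) T (W T ω).ofLp) := by
  rw [riskNeutral]
  congr 1
  ext ω
  rw [stochExp]
  congr 2
  simp only [Matrix.mulVec_neg, dotProduct, Pi.neg_apply, neg_mul, mul_neg,
    Finset.sum_neg_distrib, neg_neg]

theorem measurable_density (hW : IsCorrelatedBrownian m.R ℱ W P) (α : Fin n → ℝ) (t : ℝ≥0) :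
    Measurable fun ω => ENNReal.ofReal (stochExp m.R α t (W t ω).ofLp) :=
  (hW.measurable_stochExp α t).mono (ℱ.le t) le_rfl

theorem isProbabilityMeasure_riskNeutral [IsProbabilityMeasure P]
    (hW : IsCorrelatedBrownian m.R ℱ W P) :
    IsProbabilityMeasure (m.riskNeutral W P T) := by
  refine ⟨?_⟩
  rw [riskNeutral_eq, withDensity_apply _ MeasurableSet.univ, Measure.restrict_univ,
    hW.lintegral_stochExp m.R_posSemidef]

theorem riskNeutral_absolutelyContinuous : m.riskNeutral W P T ≪ P :=
  withDensity_absolutelyContinuous _ _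

theorem absolutelyContinuous_riskNeutral (hW : IsCorrelatedBrownian m.R ℱ W P) :
    P ≪ m.riskNeutral W P T := by
  rw [riskNeutral_eq]
  refine withDensity_absolutelyContinuous' (measurable_density hW _ _).aemeasurable ?_
  exact .of_forall fun ω => (ENNReal.ofReal_pos.2 (stochExp_pos _ _ _ _)).ne'

/-- Expectations of functions known at time `u ≤ T` only involve the density at time `u`. -/
theorem lintegral_riskNeutral (hW : IsCorrelatedBrownian m.R ℱ W P) {u : ℝ≥0} (hu : u ≤ T)
    {f : Ω → ℝ≥0∞} (hf : Measurable[ℱ u] f) :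
    ∫⁻ ω, f ω ∂m.riskNeutral W P T =
      ∫⁻ ω, f ω * ENNReal.ofReal (stochExp m.R (-m.riskPremium) u (W u ω).ofLp) ∂P := by
  -- The density process is a `P`-martingale, so on `ℱ u` the densities at times `T` and `u` define
  -- the same measure.
  have htrim : (m.riskNeutral W P T).trim (ℱ.le u) = (P.withDensity fun ω =>
      ENNReal.ofReal (stochExp m.R (-m.riskPremium) u (W u ω).ofLp)).trim (ℱ.le u) := by
    refine @Measure.ext _ (ℱ u) _ _ fun A hA => ?_
    rw [trim_measurableSet_eq _ hA, trim_measurableSet_eq _ hA, riskNeutral_eq,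
      withDensity_apply _ (ℱ.le u A hA), withDensity_apply _ (ℱ.le u A hA),
      hW.setLIntegral_stochExp m.R_posSemidef _ hu hA]
  rw [← lintegral_trim (ℱ.le u) hf, htrim, lintegral_trim (ℱ.le u) hf,
    lintegral_withDensity_eq_lintegral_mul _ (measurable_density hW _ _)
      (hf.mono (ℱ.le u) le_rfl)]
  exact lintegral_congr fun ω => mul_comm _ _

theorem measurable_riskNeutralBrownian (hW : IsCorrelatedBrownian m.R ℱ W P) (u : ℝ≥0) :
    Measurable[ℱ u] (m.riskNeutralBrownian W u) := by
  have h : Measurable fun x : EuclideanSpace ℝ (Fin n) =>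
      x.ofLp + (u : ℝ) • (m.R *ᵥ m.riskPremium) := by
    fun_prop
  exact h.comp (hW.adapted u)

theorem measurable_stochExp_apply {n : ℕ} (R : Matrix (Fin n) (Fin n) ℝ) (u : ℝ≥0) :
    Measurable fun p : (Fin n → ℝ) × (Fin n → ℝ) => stochExp R p.1 u p.2 := by
  unfold stochExp dotProduct Matrix.mulVec dotProduct
  fun_prop

theorem measurable_stochExp_riskNeutralBrownian (hW : IsCorrelatedBrownian m.R ℱ W P)
    (θ : Fin n → ℝ) (u : ℝ≥0) :
    Measurable[ℱ u] fun ω => stochExp m.R θ u (m.riskNeutralBrownian W u ω) :=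
  ((measurable_stochExp_apply m.R u).comp (measurable_prodMk_left (x := θ))).comp
    (measurable_riskNeutralBrownian hW u)

/-- The Girsanov computation: multiplying by the density shifts the exponent from `θ` to `θ - λ`,
the drift in `X` cancelling the cross term `θ'Rλ`. Martingales under `Q` thereby reduce to
martingales under `P`. -/
theorem setLIntegral_riskNeutral_stochExp_eq (hW : IsCorrelatedBrownian m.R ℱ W P) {u : ℝ≥0}
    (hu : u ≤ T) (θ : Fin n → ℝ) {A : Set Ω} (hA : MeasurableSet[ℱ u] A) :
    ∫⁻ ω in A, ENNReal.ofReal (stochExp m.R θ u (m.riskNeutralBrownian W u ω))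
        ∂m.riskNeutral W P T =
      ∫⁻ ω in A, ENNReal.ofReal (stochExp m.R (θ - m.riskPremium) u (W u ω).ofLp) ∂P := by
  have hA' := ℱ.le u A hA
  rw [← lintegral_indicator hA', ← lintegral_indicator hA', lintegral_riskNeutral hW hu
    ((measurable_stochExp_riskNeutralBrownian hW θ u).ennreal_ofReal.indicator hA)]
  refine lintegral_congr fun ω => ?_
  by_cases h : ω ∈ A
  · simp only [Set.indicator_of_mem h]
    rw [← ENNReal.ofReal_mul (stochExp_pos _ _ _ _).le]
    congr 1
    simp only [stochExp, riskNeutralBrownian]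
    rw [← Real.exp_add]
    congr 1
    simp only [dotProduct_add, dotProduct_smul, Matrix.mulVec_sub, Matrix.mulVec_neg,
      dotProduct_sub, sub_dotProduct, neg_dotProduct, dotProduct_neg, smul_eq_mul,
      m.R_isSymm.dotProduct_mulVec_comm m.riskPremium θ]
    ring
  · simp [Set.indicator_of_notMem h]

/-- Stochastic exponentials of the risk-neutral Brownian motion are risk-neutral martingales. -/
theorem setLIntegral_riskNeutral_stochExp (hW : IsCorrelatedBrownian m.R ℱ W P) {s u : ℝ≥0}
    (hsu : s ≤ u) (hu : u ≤ T) (θ : Fin n → ℝ) {A : Set Ω} (hA : MeasurableSet[ℱ s] A) :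
    ∫⁻ ω in A, ENNReal.ofReal (stochExp m.R θ u (m.riskNeutralBrownian W u ω))
        ∂m.riskNeutral W P T =
      ∫⁻ ω in A, ENNReal.ofReal (stochExp m.R θ s (m.riskNeutralBrownian W s ω))
        ∂m.riskNeutral W P T := by
  rw [setLIntegral_riskNeutral_stochExp_eq hW hu θ (ℱ.mono hsu A hA),
    setLIntegral_riskNeutral_stochExp_eq hW (hsu.trans hu) θ hA,
    hW.setLIntegral_stochExp m.R_posSemidef _ hsu hA]

/-- A single stock is the exponential with `θ = σ_i e_i`; the unit diagonal of `R` makes its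
quadratic term match the Itô correction `σ_i²/2`. -/
theorem discounted_price_eq (i : Fin n) (u : ℝ≥0) (ω : Ω) :
    Real.exp (-m.r * (u : ℝ)) * m.price W i u ω = m.S₀ i *
      stochExp m.R (Pi.single i (m.σ i)) u (m.riskNeutralBrownian W u ω) := by
  have hσ := (m.σ_pos i).ne'
  rw [price, mul_left_comm, ← Real.exp_add, stochExp, single_dotProduct, single_dotProduct,
    Matrix.mulVec_single]
  simp only [riskNeutralBrownian, Pi.add_apply, Pi.smul_apply, smul_eq_mul,
    R_mulVec_riskPremium, MulOpposite.smul_eq_mul_unop, MulOpposite.unop_op, Matrix.col_apply,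
    m.R_diag]
  congr 2
  field_simp
  ring

theorem martingale_discounted_price [IsProbabilityMeasure P]
    (hW : IsCorrelatedBrownian m.R ℱ W P) (i : Fin n) :
    Martingale (fun (u : ℝ≥0) ω => Real.exp (-m.r * ((min u T : ℝ≥0) : ℝ)) *
      m.price W i (min u T) ω) ℱ (m.riskNeutral W P T) := by
  have hQ := isProbabilityMeasure_riskNeutral (T := T) hW
  simp_rw [discounted_price_eq]
  set θ : Fin n → ℝ := Pi.single i (m.σ i)
  have hmeas : ∀ u : ℝ≥0, Measurable[ℱ u] fun ω =>
      stochExp m.R θ (min u T) (m.riskNeutralBrownian W (min u T) ω) := fun u =>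
    (measurable_stochExp_riskNeutralBrownian hW θ _).mono (ℱ.mono (min_le_left _ _)) le_rfl
  have hset : ∀ s u : ℝ≥0, s ≤ u → ∀ A, MeasurableSet[ℱ s] A →
      ∫⁻ ω in A, ENNReal.ofReal
        (stochExp m.R θ (min u T) (m.riskNeutralBrownian W (min u T) ω)) ∂m.riskNeutral W P T =
      ∫⁻ ω in A, ENNReal.ofReal
        (stochExp m.R θ (min s T) (m.riskNeutralBrownian W (min s T) ω))
          ∂m.riskNeutral W P T := by
    intro s u hsu A hA
    -- After `T` the process is frozen, so only the case `s ≤ T` uses the martingale property.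
    rcases le_total s T with hs | hs
    · refine setLIntegral_riskNeutral_stochExp hW (min_le_min_right T hsu) (min_le_right _ _) θ ?_
      rwa [min_eq_left hs]
    · rw [min_eq_right hs, min_eq_right (hs.trans hsu)]
  have hint : ∀ u : ℝ≥0, Integrable (fun ω =>
      stochExp m.R θ (min u T) (m.riskNeutralBrownian W (min u T) ω))
        (m.riskNeutral W P T) := by
    intro u
    refine ⟨((hmeas u).mono (ℱ.le u) le_rfl).aestronglyMeasurable, ?_⟩
    rw [hasFiniteIntegral_iff_ofReal (.of_forall fun ω => (stochExp_pos _ _ _ _).le)]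
    have h := setLIntegral_riskNeutral_stochExp_eq (T := T) hW (min_le_right u T) θ
      MeasurableSet.univ
    have h2 := hW.lintegral_stochExp m.R_posSemidef (θ - m.riskPremium) (min u T)
    rw [Measure.restrict_univ, Measure.restrict_univ, h2] at h
    rw [h]
    exact ENNReal.one_lt_top
  refine Martingale.smul (m.S₀ i) (f := fun u ω =>
    stochExp m.R θ (min u T) (m.riskNeutralBrownian W (min u T) ω))
    ⟨fun u => (hmeas u).stronglyMeasurable, fun s u hsu => ?_⟩
  refine (ae_eq_condExp_of_forall_setIntegral_eq (ℱ.le s) (hint u)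
    (fun A _ _ => (hint s).integrableOn) (fun A hA _ => ?_)
    (hmeas s).stronglyMeasurable.aestronglyMeasurable).symm
  rw [integral_eq_lintegral_of_nonneg_ae (.of_forall fun ω => (stochExp_pos _ _ _ _).le)
      (hint s).integrableOn.aestronglyMeasurable,
    integral_eq_lintegral_of_nonneg_ae (.of_forall fun ω => (stochExp_pos _ _ _ _).le)
      (hint u).integrableOn.aestronglyMeasurable, hset s u hsu A hA]

theorem isEquivalentMartingaleMeasure_riskNeutral [IsProbabilityMeasure P]
    (hW : IsCorrelatedBrownian m.R ℱ W P) :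
    m.IsEquivalentMartingaleMeasure W ℱ P T (m.riskNeutral W P T) where
  isProbability := isProbabilityMeasure_riskNeutral hW
  absolutelyContinuous := riskNeutral_absolutelyContinuous
  absolutelyContinuous' := absolutelyContinuous_riskNeutral hW
  martingale := martingale_discounted_price hW

variable (m W) in
/-- The discounted best wealth in hindsight, deflated by its growth rate. Up to a constant it is the
wealth of the universal portfolio. -/
def deflatedMax (u : ℝ≥0) (ω : Ω) : ℝ :=
  (u : ℝ) ^ (-((n : ℝ) / 2)) * maxStochExp m.R u (m.riskNeutralBrownian W u ω)

theorem continuous_maxStochExp_apply {n : ℕ} (R : Matrix (Fin n) (Fin n) ℝ) (u : ℝ≥0) :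
    Continuous (maxStochExp R u) := by
  unfold maxStochExp stochExpArgmax stochExp dotProduct Matrix.mulVec dotProduct
  fun_prop

theorem measurable_maxStochExp_riskNeutralBrownian (hW : IsCorrelatedBrownian m.R ℱ W P)
    (u : ℝ≥0) : Measurable[ℱ u] fun ω => maxStochExp m.R u (m.riskNeutralBrownian W u ω) :=
  (continuous_maxStochExp_apply m.R u).measurable.comp (measurable_riskNeutralBrownian hW u)

theorem measurable_deflatedMax (hW : IsCorrelatedBrownian m.R ℱ W P) (u : ℝ≥0) :
    Measurable[ℱ u] (m.deflatedMax W u) :=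
  (measurable_maxStochExp_riskNeutralBrownian hW u).const_mul _

theorem continuousOn_deflatedMax {t : ℝ≥0} (ht : 0 < t) {ω : Ω} (hω : Continuous fun u => W u ω) :
    ContinuousOn (fun u => m.deflatedMax W u ω) (Set.Icc t T) := by
  have h0 : ∀ u ∈ Set.Icc t T, ((u : ℝ≥0) : ℝ) ≠ 0 := fun u hu => by
    exact_mod_cast (ht.trans_le hu.1).ne'
  have hX : Continuous fun u => m.riskNeutralBrownian W u ω := by
    unfold riskNeutralBrownian
    fun_prop
  have hXi : ∀ i, Continuous fun u => m.riskNeutralBrownian W u ω i := fun i =>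
    (continuous_apply i).comp hX
  have hc : ContinuousOn (fun u : ℝ≥0 => (u : ℝ)) (Set.Icc t T) :=
    NNReal.continuous_coe.continuousOn
  have hinv : ContinuousOn (fun u : ℝ≥0 => (u : ℝ)⁻¹) (Set.Icc t T) := hc.inv₀ h0
  have hXi' := fun i => (hXi i).continuousOn (s := Set.Icc t T)
  unfold deflatedMax maxStochExp stochExpArgmax stochExp dotProduct Matrix.mulVec dotProduct
  refine (hc.rpow_const fun u hu => .inl (h0 u hu)).mul ?_
  simp only [Pi.smul_apply, smul_eq_mul]
  fun_prop

/-- Tonelli exchanges the integral over `θ` with the one over `A`. The martingale identity then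
holds for each `θ` separately, and the common Gaussian mass cancels. -/
theorem setLIntegral_deflatedMax [IsProbabilityMeasure P] (hW : IsCorrelatedBrownian m.R ℱ W P)
    {s u : ℝ≥0} (hs : 0 < s) (hsu : s ≤ u) (hu : u ≤ T) {A : Set Ω} (hA : MeasurableSet[ℱ s] A) :
    ∫⁻ ω in A, ENNReal.ofReal (m.deflatedMax W u ω) ∂m.riskNeutral W P T =
      ∫⁻ ω in A, ENNReal.ofReal (m.deflatedMax W s ω) ∂m.riskNeutral W P T := by
  have hQ := isProbabilityMeasure_riskNeutral (T := T) hW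
  have hmix : ∀ v : ℝ≥0, 0 < v →
      (∫⁻ ω in A, ENNReal.ofReal (m.deflatedMax W v ω) ∂m.riskNeutral W P T) *
        gaussianMass m.R = ∫⁻ θ, ∫⁻ ω in A,
          ENNReal.ofReal (stochExp m.R θ v (m.riskNeutralBrownian W v ω))
            ∂m.riskNeutral W P T := by
    intro v hv
    have hmeas : Measurable fun p : (Fin n → ℝ) × Ω =>
        ENNReal.ofReal (stochExp m.R p.1 v (m.riskNeutralBrownian W v p.2)) :=
      ((measurable_stochExp_apply m.R v).comp (measurable_fst.prodMk
        (((measurable_riskNeutralBrownian hW v).mono (ℱ.le v) le_rfl).comp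
          measurable_snd))).ennreal_ofReal
    rw [lintegral_lintegral_swap hmeas.aemeasurable,
      ← lintegral_mul_const' _ _ (gaussianMass_ne_top m.R_posSemidef m.R_isUnit)]
    simp_rw [lintegral_stochExp_mixture m.R_posSemidef m.R_isUnit hv]
    rfl
  have h := (hmix u (hs.trans_le hsu)).trans ((lintegral_congr fun θ =>
    setLIntegral_riskNeutral_stochExp hW hsu hu θ hA).trans (hmix s hs).symm)
  exact (ENNReal.mul_left_inj (gaussianMass_ne_zero _)
    (gaussianMass_ne_top m.R_posSemidef m.R_isUnit)).1 h

theorem deflatedMax_pos {u : ℝ≥0} (hu : 0 < u) (ω : Ω) : 0 < m.deflatedMax W u ω :=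
  mul_pos (Real.rpow_pos_of_pos (by exact_mod_cast hu) _) (stochExp_pos _ _ _ _)

end GBMMarket

/-! ### European and American prices of the derivative -/

namespace GBMMarket

variable {Ω : Type*} {mΩ : MeasurableSpace Ω} {n : ℕ} {m : GBMMarket n}
  {W : ℝ≥0 → Ω → EuclideanSpace ℝ (Fin n)} {ℱ : Filtration ℝ≥0 mΩ} {P : Measure Ω} {t T : ℝ≥0}

variable (m) in
/-- The growth rate of the best wealth in hindsight, discounted to time `t`. -/
def hindsightWeight (t u : ℝ≥0) : ℝ :=
  Real.exp (m.r * t) * (u : ℝ) ^ ((n : ℝ) / 2)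

theorem hindsightWeight_pos {u : ℝ≥0} (hu : 0 < u) : 0 < m.hindsightWeight t u :=
  mul_pos (Real.exp_pos _) (Real.rpow_pos_of_pos (by exact_mod_cast hu) _)

theorem strictMono_hindsightWeight (hn : 1 ≤ n) : StrictMono (m.hindsightWeight t) := by
  intro u v huv
  have hn' : (0 : ℝ) < n := by exact_mod_cast hn
  exact mul_lt_mul_of_pos_left (Real.rpow_lt_rpow u.coe_nonneg (by exact_mod_cast huv)
    (by positivity)) (Real.exp_pos _)

/-- This separates the discounted payoff into a deterministic increasing weight and a martingale,
the form required by the stopping lemmas. -/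
theorem discounted_hindsightWealth {u : ℝ≥0} (hu : 0 < u) (ω : Ω) :
    Real.exp (-m.r * ((u : ℝ) - (t : ℝ))) * m.hindsightWealth W u ω =
      m.hindsightWeight t u * m.deflatedMax W u ω := by
  have hu' : (0 : ℝ) < u := by exact_mod_cast hu
  rw [hindsightWealth_eq _ _ hu, hindsightWeight, deflatedMax, ← mul_assoc, ← Real.exp_add,
    mul_assoc, ← mul_assoc ((u : ℝ) ^ ((n : ℝ) / 2)), ← Real.rpow_add hu', add_neg_cancel,
    Real.rpow_zero, one_mul]
  ring_nf

theorem hindsightWeight_mul_deflatedMax (ht : 0 < t) (ω : Ω) :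
    m.hindsightWeight t T * m.deflatedMax W t ω =
      ((T : ℝ) / t) ^ ((n : ℝ) / 2) * m.hindsightWealth W t ω := by
  have ht' : (0 : ℝ) < t := by exact_mod_cast ht
  rw [hindsightWealth_eq _ _ ht, hindsightWeight, deflatedMax,
    Real.div_rpow T.coe_nonneg t.coe_nonneg, Real.rpow_neg ht'.le]
  ring

theorem valueOfExercise_hindsightWealth (Q : Measure Ω) (ht : 0 < t) {τ : Ω → ℝ≥0}
    (hτ : IsExerciseTime ℱ t T τ) :
    valueOfExercise Q ℱ m.r (m.hindsightWealth W) t τ =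
      condLExp (ℱ t) Q fun ω =>
        ENNReal.ofReal (m.hindsightWeight t (τ ω) * m.deflatedMax W (τ ω) ω) := by
  rw [valueOfExercise]
  simp_rw [discounted_hindsightWealth (ht.trans_le (hτ.ge_start _))]

theorem isExerciseTime_expiry (ℱ : Filtration ℝ≥0 mΩ) (htT : t ≤ T) :
    IsExerciseTime ℱ t T fun _ => T where
  isStoppingTime := isStoppingTime_const ℱ T
  ge_start _ := htT
  le_expiry _ := le_rfl

theorem continuousOn_deflatedMax_ae (hW : IsCorrelatedBrownian m.R ℱ W P) (ht : 0 < t) :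
    ∀ᵐ ω ∂m.riskNeutral W P T, ContinuousOn (fun u => m.deflatedMax W u ω) (Set.Icc t T) := by
  filter_upwards [riskNeutral_absolutelyContinuous.ae_le hW.continuous_paths] with ω hω
  exact continuousOn_deflatedMax ht hω

variable [IsProbabilityMeasure P]

theorem europeanPrice_hindsightWealth (hW : IsCorrelatedBrownian m.R ℱ W P) (ht : 0 < t)
    (htT : t ≤ T) :
    europeanPrice (m.riskNeutral W P T) ℱ m.r (m.hindsightWealth W) T t
      =ᵐ[m.riskNeutral W P T]
        fun ω => ENNReal.ofReal (m.hindsightWeight t T * m.deflatedMax W t ω) := by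
  have hQ := isProbabilityMeasure_riskNeutral (T := T) hW
  rw [europeanPrice, valueOfExercise_hindsightWealth _ ht (isExerciseTime_expiry ℱ htT)]
  exact condLExp_weighted_horizon htT (measurable_deflatedMax hW t)
    (fun s hs hsT A hA => setLIntegral_deflatedMax hW (ht.trans_le hs) hsT le_rfl hA)
    (hindsightWeight_pos (ht.trans_le htT)).le

theorem valueOfExercise_le_europeanPrice (hW : IsCorrelatedBrownian m.R ℱ W P) (hn : 1 ≤ n)
    (ht : 0 < t) (htT : t ≤ T) {τ : Ω → ℝ≥0} (hτ : IsExerciseTime ℱ t T τ) :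
    valueOfExercise (m.riskNeutral W P T) ℱ m.r (m.hindsightWealth W) t τ
      ≤ᵐ[m.riskNeutral W P T]
        europeanPrice (m.riskNeutral W P T) ℱ m.r (m.hindsightWealth W) T t := by
  have hQ := isProbabilityMeasure_riskNeutral (T := T) hW
  refine Filter.EventuallyLE.trans_eq ?_ (europeanPrice_hindsightWealth hW ht htT).symm
  rw [valueOfExercise_hindsightWealth _ ht hτ]
  exact condLExp_weighted_stopped_le hτ htT
    (fun s => (measurable_deflatedMax hW s).mono (ℱ.le s) le_rfl) (measurable_deflatedMax hW t)
    (fun s hs => deflatedMax_pos (ht.trans_le hs))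
    (fun s hs hsT A hA => setLIntegral_deflatedMax hW (ht.trans_le hs) hsT le_rfl hA)
    (continuousOn_deflatedMax_ae hW ht) (hindsightWeight_pos (ht.trans_le htT)).le
    (strictMono_hindsightWeight hn)

/-- The European price bounds every exercise value and is itself the value of waiting until `T`, so
it is the essential supremum. -/
theorem isAmericanPrice_europeanPrice (hW : IsCorrelatedBrownian m.R ℱ W P) (hn : 1 ≤ n)
    (ht : 0 < t) (htT : t ≤ T) :
    IsAmericanPrice (m.riskNeutral W P T) ℱ m.r (m.hindsightWealth W) T t
      (europeanPrice (m.riskNeutral W P T) ℱ m.r (m.hindsightWealth W) T t) where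
  measurable := measurable_condLExp _ _ _
  value_le _ hτ := valueOfExercise_le_europeanPrice hW hn ht htT hτ
  le_of_value_le _ _ hY := hY _ (isExerciseTime_expiry ℱ htT)

theorem isOptimalExercise_iff (hW : IsCorrelatedBrownian m.R ℱ W P) (hn : 1 ≤ n)
    (ht : 0 < t) (htT : t ≤ T) {τ : Ω → ℝ≥0} (hτ : IsExerciseTime ℱ t T τ) :
    IsOptimalExercise (m.riskNeutral W P T) ℱ m.r (m.hindsightWealth W) T t τ ↔
      ∀ᵐ ω ∂P, τ ω = T := by
  have hQ := isProbabilityMeasure_riskNeutral (T := T) hW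
  constructor
  · intro h
    have heq : valueOfExercise (m.riskNeutral W P T) ℱ m.r (m.hindsightWealth W) t τ
        =ᵐ[m.riskNeutral W P T]
          fun ω => ENNReal.ofReal (m.hindsightWeight t T * m.deflatedMax W t ω) :=
      -- An optimal value dominates that of waiting until `T` and is dominated by it, hence equals
      -- the European price.
      ((valueOfExercise_le_europeanPrice hW hn ht htT hτ).antisymm
        (h.value_le _ (isExerciseTime_expiry ℱ htT))).trans
          (europeanPrice_hindsightWealth hW ht htT)
    rw [valueOfExercise_hindsightWealth _ ht hτ] at heq
    exact (absolutelyContinuous_riskNeutral hW).ae_le (eq_horizon_of_condLExp_weighted_eq hτ htT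
      (fun s => (measurable_deflatedMax hW s).mono (ℱ.le s) le_rfl) (measurable_deflatedMax hW t)
      (fun s hs => deflatedMax_pos (ht.trans_le hs))
      (fun s hs hsT A hA => setLIntegral_deflatedMax hW (ht.trans_le hs) hsT le_rfl hA)
      (continuousOn_deflatedMax_ae hW ht) (hindsightWeight_pos (ht.trans_le htT))
      (strictMono_hindsightWeight hn) heq)
  · intro h
    have heq : valueOfExercise (m.riskNeutral W P T) ℱ m.r (m.hindsightWealth W) t τ
        =ᵐ[m.riskNeutral W P T]
          europeanPrice (m.riskNeutral W P T) ℱ m.r (m.hindsightWealth W) T t := by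
      refine condLExp_congr_ae ?_
      filter_upwards [riskNeutral_absolutelyContinuous.ae_le h] with ω hω
      rw [hω]
    have hE := isAmericanPrice_europeanPrice hW hn ht htT
    exact ⟨measurable_condLExp _ _ _, fun σ hσ => (hE.value_le σ hσ).trans_eq heq.symm,
      fun Y hY hle => hle τ hτ⟩

theorem hindsightWealth_lt_growth (hn : 1 ≤ n) (ht : 0 < t) (htT : t < T) (ω : Ω) :
    ENNReal.ofReal (m.hindsightWealth W t ω) <
      ENNReal.ofReal (((T : ℝ) / t) ^ ((n : ℝ) / 2) * m.hindsightWealth W t ω) := by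
  have ht' : (0 : ℝ) < t := by exact_mod_cast ht
  have hn' : (0 : ℝ) < n := by exact_mod_cast hn
  have hV : 0 < m.hindsightWealth W t ω := by
    rw [hindsightWealth_eq _ _ ht]
    exact mul_pos (Real.exp_pos _) (stochExp_pos _ _ _ _)
  have h1 : 1 < ((T : ℝ) / t) ^ ((n : ℝ) / 2) :=
    Real.one_lt_rpow ((one_lt_div ht').2 (by exact_mod_cast htT)) (by positivity)
  rw [ENNReal.ofReal_lt_ofReal_iff (by positivity)]
  exact lt_mul_of_one_lt_left hV h1

end GBMMarket

end

theorem theorem6 {Ω : Type*} {mΩ : MeasurableSpace Ω} (P : Measure Ω) [IsProbabilityMeasure P]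
    (ℱ : Filtration ℝ≥0 mΩ) {n : ℕ} (hn : 1 ≤ n) (m : GBMMarket n)
    (W : ℝ≥0 → Ω → EuclideanSpace ℝ (Fin n)) (hW : IsCorrelatedBrownian m.R ℱ W P) (T : ℝ≥0) :
    -- the pricing measure is an equivalent martingale measure
    m.IsEquivalentMartingaleMeasure W ℱ P T (m.riskNeutral W P T) ∧
    -- the intrinsic value is the maximum of the wealth over all rebalancing rules
    (∀ t : ℝ≥0, 0 < t → ∀ ω,
      IsGreatest (Set.range fun b : Fin n → ℝ => m.wealth W b t ω) (m.hindsightWealth W t ω)) ∧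
    ∀ t : ℝ≥0, 0 < t → t ≤ T →
      -- the European price
      (∀ᵐ ω ∂P, europeanPrice (m.riskNeutral W P T) ℱ m.r (m.hindsightWealth W) T t ω =
        ENNReal.ofReal (((T : ℝ) / (t : ℝ)) ^ ((n : ℝ) / 2) * m.hindsightWealth W t ω)) ∧
      -- the American price is equal to the European price
      IsAmericanPrice (m.riskNeutral W P T) ℱ m.r (m.hindsightWealth W) T t
        (europeanPrice (m.riskNeutral W P T) ℱ m.r (m.hindsightWealth W) T t) ∧
      -- which exceeds the intrinsic value before expiry
      (t < T → ∀ᵐ ω ∂P, ENNReal.ofReal (m.hindsightWealth W t ω) <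
        europeanPrice (m.riskNeutral W P T) ℱ m.r (m.hindsightWealth W) T t ω) ∧
      -- no early exercise: an exercise policy is optimal iff it almost surely waits until expiry
      (∀ τ : Ω → ℝ≥0, IsExerciseTime ℱ t T τ →
        (IsOptimalExercise (m.riskNeutral W P T) ℱ m.r (m.hindsightWealth W) T t τ ↔
          ∀ᵐ ω ∂P, τ ω = T)) := by
  refine ⟨GBMMarket.isEquivalentMartingaleMeasure_riskNeutral hW, fun t ht ω => ?_,
    fun t ht htT => ?_⟩
  · rw [m.hindsightWealth_eq W ht]
    exact m.isGreatest_wealth W ht ω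
  have hE : ∀ᵐ ω ∂P, europeanPrice (m.riskNeutral W P T) ℱ m.r (m.hindsightWealth W) T t ω =
      ENNReal.ofReal (((T : ℝ) / (t : ℝ)) ^ ((n : ℝ) / 2) * m.hindsightWealth W t ω) := by
    filter_upwards [(GBMMarket.absolutelyContinuous_riskNeutral hW).ae_le
      (GBMMarket.europeanPrice_hindsightWealth hW ht htT)] with ω hω
    rw [hω, GBMMarket.hindsightWeight_mul_deflatedMax ht]
  refine ⟨hE, GBMMarket.isAmericanPrice_europeanPrice hW hn ht htT, fun hlt => ?_,
    fun τ hτ => GBMMarket.isOptimalExercise_iff hW hn ht htT hτ⟩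
  filter_upwards [hE] with ω hω
  rw [hω]
  exact GBMMarket.hindsightWealth_lt_growth hn ht hlt ω
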